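/- Let $k$ be a perfect field of characteristic $2$ (for instance $k=\mathbb{F}_q$ with $q$ a power of $2$, or $k=\overline{\mathbb{F}}_q$), and let $A,B\in k[t]$ be polynomials of odd degree. Then the affine curve $$r^2+r=A(t),\qquad s^2+s=rA(t)+B(t)$$ over $k$ is integral, i.e. $k[t,r,s]/(r^2+r-A,\ s^2+s-rA-B)$ is an integral domain, and the smooth projective curve $C$ over $k$ whose function field is the fraction field $k(t,r,s)$ of this ring has genus $$g(C)=\max\left\{\frac{5\deg A-3}{2},\ \frac{2\deg B+\deg A-3}{2}\right\}.$$ Here the genus is the dimension over $k$ of the space of everywhere regular differentials on $C$. -/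

import Mathlib

open Polynomial

noncomputable section

namespace ArtinSchreierQuartic

/-- A Kähler differential `ω` of `F / k` is regular at the valuation ring `O` if it lies in the
`O`-submodule of `Ω[F⁄k]` generated by the differentials `dx`, `x ∈ O`, i.e. in the image of
`Ω[O⁄k]`. -/
def IsRegularAt (k F : Type*) [Field k] [Field F] [Algebra k F] (O : ValuationSubring F)
    (ω : Ω[F⁄k]) : Prop :=
  ω ∈ Submodule.span O.toSubring (KaehlerDifferential.D k F '' (O : Set F))

/-- The `k`-vector space of everywhere regular differentials of `F / k`. When `F` is the function
field of a smooth projective curve `X` over `k`, the local rings of `X` are exactly the valuation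
rings of `F` that contain `k` (the ring `O = ⊤` belongs to the generic point and imposes no
condition), so this is the space of global sections of the sheaf of differentials of `X / k`. -/
def regularDifferentials (k F : Type*) [Field k] [Field F] [Algebra k F] :
    Submodule k (Ω[F⁄k]) where
  carrier := {ω | ∀ O : ValuationSubring F, (∀ c : k, algebraMap k F c ∈ O) →
    IsRegularAt k F O ω}
  zero_mem' := fun _ _ => Submodule.zero_mem _
  add_mem' := fun ha hb O hO => Submodule.add_mem _ (ha O hO) (hb O hO)
  smul_mem' := fun c ω hω O hO => by
    have h := Submodule.smul_mem _ (⟨algebraMap k F c, hO c⟩ : O.toSubring) (hω O hO)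
    have e : (⟨algebraMap k F c, hO c⟩ : O.toSubring) • ω = c • ω :=
      algebraMap_smul F c ω
    rw [e] at h
    exact h

/-- The genus of a function field `F` of one variable over a perfect field `k`, that is, of the
smooth projective curve over `k` with function field `F`: the dimension of the space of everywhere
regular differentials. -/
def genus (k F : Type*) [Field k] [Field F] [Algebra k F] : ℕ :=
  Module.finrank k (regularDifferentials k F)

variable {k : Type*} [Field k]

/-- The coordinate ring `k[t, r] / (r² + r - A(t))` of the affine curve `H`. -/
abbrev CoordRingH (A : k[X]) : Type _ :=
  AdjoinRoot (X ^ 2 + X - C A : k[X][X])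

/-- The function `r` on `H`. -/
abbrev r (A : k[X]) : CoordRingH A := AdjoinRoot.root _

/-- The coordinate ring `k[t, r, s] / (r² + r - A(t), s² + s - (r A(t) + B(t)))` of the affine
curve `C`. -/
abbrev CoordRingC (A B : k[X]) : Type _ :=
  AdjoinRoot (X ^ 2 + X - C (r A * AdjoinRoot.of _ A + AdjoinRoot.of _ B) : (CoordRingH A)[X])

end ArtinSchreierQuartic

end

/-! Write a = deg A and b = deg B. In characteristic 2 the polynomials X² + X - c have derivative 1,
so the affine curve is étale over the t-line. Its coordinate ring R is therefore a Dedekind domain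
once it is a domain, the differentials of the function field are free on dt, and ω = f dt is regular
at the finite places exactly when f lies in R. Everything else happens over t = ∞.

There, pole orders are read off by comparing v(x)⁴ with powers of v(t), for any valuation with v(t)
> 1; nothing about the value group is needed. The order of r is 2a. As k is perfect, a translate of
s satisfies s² + s = p + q r with 2 deg p < 2d + a, where d = deg q = max(a, b - a)
(`exists_artinSchreier_reduction`), so the translate has the odd order 2d + a. These orders do not
occur one level down, so neither equation has a root there, which gives integrality. Moreover 1, r,
s, rs have orders distinct mod 4, so the terms of a combination over k(t) never cancel
(`IsReducedTower.le_map_sum`).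

Set N = 2d + 3a - 5. On a valuation ring at infinity d/dt takes values of pole order at most N, and
N is attained (`poleLE_derivation`, `exists_hasPole_derivation`). So dt vanishes to order N, and f
dt is regular there iff f has pole order at most N. Counting the polynomial coefficients of 1, r, s,
rs that this allows gives g = (2d + 3a - 3)/2, in accordance with 2g - 2 = N
(`IsReducedTower.genus_eq`). -/

noncomputable section

namespace ArtinSchreierQuartic

/-! ### Artin–Schreier extensions of a ring: primality, étaleness, normality -/

section ArtinSchreier

variable {H : Type*} [CommRing H] (c : H)

theorem artinSchreier_natDegree [Nontrivial H] : (X ^ 2 + X - C c : H[X]).natDegree = 2 := by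
  compute_degree!

theorem artinSchreier_monic : (X ^ 2 + X - C c : H[X]).Monic := by
  nontriviality H
  rw [show (X ^ 2 + X - C c : H[X]) = X ^ 2 + (X - C c) by ring]
  exact monic_X_pow_add (by compute_degree!)

theorem artinSchreier_root :
    AdjoinRoot.root (X ^ 2 + X - C c) ^ 2 + AdjoinRoot.root (X ^ 2 + X - C c) =
      AdjoinRoot.of (X ^ 2 + X - C c) c := by
  have h := AdjoinRoot.eval₂_root (X ^ 2 + X - C c)
  simp only [eval₂_sub, eval₂_add, eval₂_pow, eval₂_X, eval₂_C] at h
  exact sub_eq_zero.mp h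

theorem artinSchreier_exists_eq (y : AdjoinRoot (X ^ 2 + X - C c)) :
    ∃ a b : H, y = AdjoinRoot.of _ a + AdjoinRoot.of _ b * AdjoinRoot.root _ := by
  cases subsingleton_or_nontrivial H
  · have := (AdjoinRoot.mk_surjective (g := (X ^ 2 + X - C c : H[X]))).subsingleton
    exact ⟨0, 0, Subsingleton.elim _ _⟩
  obtain ⟨g, rfl⟩ := AdjoinRoot.mk_surjective y
  have hm := artinSchreier_monic c
  have hd : (g %ₘ (X ^ 2 + X - C c)).degree ≤ 1 := by
    have h := degree_modByMonic_lt g hm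
    rw [degree_eq_natDegree hm.ne_zero, artinSchreier_natDegree] at h
    exact Order.le_of_lt_succ h
  refine ⟨(g %ₘ (X ^ 2 + X - C c)).coeff 0, (g %ₘ (X ^ 2 + X - C c)).coeff 1, ?_⟩
  have h1 : AdjoinRoot.mk (X ^ 2 + X - C c) g =
      AdjoinRoot.mk (X ^ 2 + X - C c) (g %ₘ (X ^ 2 + X - C c)) := by
    rw [AdjoinRoot.mk_eq_mk, modByMonic_eq_sub_mul_div g]
    exact ⟨g /ₘ (X ^ 2 + X - C c), by ring⟩
  rw [h1]
  conv_lhs => rw [eq_X_add_C_of_degree_le_one hd]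
  simp only [map_add, map_mul, AdjoinRoot.mk_C, AdjoinRoot.mk_X]
  ring

instance artinSchreier_finite : Module.Finite H (AdjoinRoot (X ^ 2 + X - C c)) :=
  (artinSchreier_monic c).finite_adjoinRoot

/-- A quadratic without roots in K is prime in K[X], and divisibility by a monic polynomial descends
from K[X] to H[X]. -/
theorem artinSchreier_prime {K : Type*} [Field K] [Algebra H K] [FaithfulSMul H K]
    (h : ∀ z : K, z ^ 2 + z ≠ algebraMap H K c) : Prime (X ^ 2 + X - C c : H[X]) := by
  have hinj : Function.Injective (algebraMap H K) := FaithfulSMul.algebraMap_injective H K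
  have := hinj.isDomain (algebraMap H K)
  have hm := artinSchreier_monic c
  have hmap : (X ^ 2 + X - C c : H[X]).map (algebraMap H K) = X ^ 2 + X - C (algebraMap H K c) := by
    simp
  have hp : Prime (X ^ 2 + X - C (algebraMap H K c) : K[X]) := by
    refine (irreducible_of_degree_le_three_of_not_isRoot ?_ fun z hz => h z ?_).prime
    · rw [artinSchreier_natDegree]; decide
    · simpa [sub_eq_zero] using hz
  rw [← hmap] at hp
  refine ⟨hm.ne_zero, fun hu => hp.not_isUnit (hu.map (mapRingHom (algebraMap H K))),
    fun a b hab => ?_⟩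
  rw [← map_dvd_map _ hinj hm, Polynomial.map_mul] at hab
  rw [← map_dvd_map _ hinj hm, ← map_dvd_map _ hinj hm]
  exact hp.dvd_or_dvd hab

theorem artinSchreier_of_injective [IsDomain H] :
    Function.Injective (AdjoinRoot.of (X ^ 2 + X - C c)) :=
  AdjoinRoot.of.injective_of_degree_ne_zero (by
    rw [degree_eq_natDegree (artinSchreier_monic c).ne_zero, artinSchreier_natDegree]
    decide)

variable [CharP H 2]

/-- The Artin–Schreier polynomial together with the invertible polynomial `1`. -/
def artinSchreierPair : StandardEtalePair H where
  f := X ^ 2 + X - C c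
  monic_f := artinSchreier_monic c
  g := 1
  cond := ⟨1, 0, 0, by
    simp [derivative_pow, CharTwo.two_eq_zero]⟩

instance artinSchreier_formallyEtale :
    Algebra.FormallyEtale H (AdjoinRoot (X ^ 2 + X - C c)) := by
  have h : Algebra.FormallyEtale H (AdjoinRoot (artinSchreierPair c).f) := by
    have hu : IsUnit (AdjoinRoot.mk (artinSchreierPair c).f (artinSchreierPair c).g) := by
      rw [show (artinSchreierPair c).g = 1 from rfl, map_one]
      exact isUnit_one
    have : IsLocalization.Away (AdjoinRoot.mk (artinSchreierPair c).f (artinSchreierPair c).g)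
        (AdjoinRoot (artinSchreierPair c).f) :=
      IsLocalization.away_of_isUnit_of_bijective _ hu Function.bijective_id
    exact .of_equiv ((artinSchreierPair c).equivAwayAdjoinRoot.trans
      ((IsLocalization.algEquiv (Submonoid.powers
        (AdjoinRoot.mk (artinSchreierPair c).f (artinSchreierPair c).g)) _ _).restrictScalars H))
  exact h

theorem artinSchreier_two_eq_zero : (2 : AdjoinRoot (X ^ 2 + X - C c)) = 0 := by
  have h := congrArg (AdjoinRoot.of (X ^ 2 + X - C c)) (CharTwo.two_eq_zero (R := H))
  rwa [map_ofNat, map_zero] at h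

/-- The conjugation `s ↦ s + 1` of an Artin–Schreier extension. -/
def artinSchreierConj :
    AdjoinRoot (X ^ 2 + X - C c) →ₐ[H] AdjoinRoot (X ^ 2 + X - C c) :=
  AdjoinRoot.liftAlgHom _ (Algebra.ofId _ _) (AdjoinRoot.root _ + 1) (by
    have h := artinSchreier_root c
    have h2 := artinSchreier_two_eq_zero c
    simp only [eval₂_sub, eval₂_add, eval₂_pow, eval₂_X, eval₂_C]
    change (AdjoinRoot.root _ + 1) ^ 2 + (AdjoinRoot.root _ + 1) - AdjoinRoot.of _ c = 0
    linear_combination h + (AdjoinRoot.root _ + 1) * h2)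

theorem artinSchreierConj_root :
    artinSchreierConj c (AdjoinRoot.root _) = AdjoinRoot.root _ + 1 := by
  simp [artinSchreierConj]

theorem artinSchreierConj_of_add_of_mul_root (a b : H) :
    artinSchreierConj c (AdjoinRoot.of _ a + AdjoinRoot.of _ b * AdjoinRoot.root _) =
      AdjoinRoot.of _ a + AdjoinRoot.of _ b * (AdjoinRoot.root _ + 1) := by
  rw [map_add, map_mul, artinSchreierConj_root]
  congr 1
  · exact (artinSchreierConj c).commutes a
  · congr 1
    exact (artinSchreierConj c).commutes b

theorem artinSchreierConj_conj (y : AdjoinRoot (X ^ 2 + X - C c)) :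
    artinSchreierConj c (artinSchreierConj c y) = y := by
  obtain ⟨a, b, rfl⟩ := artinSchreier_exists_eq c y
  rw [artinSchreierConj_of_add_of_mul_root, mul_add, mul_one, ← add_assoc, add_right_comm,
    ← map_add, artinSchreierConj_of_add_of_mul_root, map_add]
  linear_combination AdjoinRoot.of (X ^ 2 + X - C c) b * artinSchreier_two_eq_zero c

theorem artinSchreier_mul_conj_mem (y : AdjoinRoot (X ^ 2 + X - C c)) :
    ∃ n : H, y * artinSchreierConj c y = AdjoinRoot.of _ n := by
  obtain ⟨a, b, rfl⟩ := artinSchreier_exists_eq c y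
  refine ⟨a ^ 2 + a * b + b ^ 2 * c, ?_⟩
  rw [artinSchreierConj_of_add_of_mul_root]
  simp only [map_add, map_mul, map_pow]
  linear_combination AdjoinRoot.of (X ^ 2 + X - C c) b ^ 2 * artinSchreier_root c +
    AdjoinRoot.of (X ^ 2 + X - C c) a * AdjoinRoot.of (X ^ 2 + X - C c) b * AdjoinRoot.root _ *
      artinSchreier_two_eq_zero c

theorem artinSchreier_charP [IsDomain H] : CharP (AdjoinRoot (X ^ 2 + X - C c)) 2 :=
  charP_of_injective_ringHom (artinSchreier_of_injective c) 2

/-- The trace of a + b s is b, since s ↦ s + 1 and 2 = 0. So for an integral x = (a + b s)/z both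
b/z and x - (b/z) s = a/z are integral over H, hence lie in H. -/
theorem artinSchreier_isIntegrallyClosed [IsDomain H] [IsIntegrallyClosed H]
    [IsDomain (AdjoinRoot (X ^ 2 + X - C c))] :
    IsIntegrallyClosed (AdjoinRoot (X ^ 2 + X - C c)) := by
  set S := AdjoinRoot (X ^ 2 + X - C c) with hS
  set s : S := AdjoinRoot.root (X ^ 2 + X - C c) with hs
  let L := FractionRing S
  have hSL : Function.Injective (algebraMap S L) := IsFractionRing.injective S L
  have hHS : Function.Injective (algebraMap H S) := artinSchreier_of_injective c
  have hHL : Function.Injective (algebraMap H L) := by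
    rw [IsScalarTower.algebraMap_eq H S L]
    exact hSL.comp hHS
  have two : (2 : L) = 0 := by
    rw [← map_ofNat (algebraMap S L) 2, artinSchreier_two_eq_zero, map_zero]
  let ι : FractionRing H →ₐ[H] L := IsFractionRing.liftAlgHom (g := Algebra.ofId H L) hHL
  have key : ∀ a z : H, z ≠ 0 → IsIntegral H (algebraMap H L a / algebraMap H L z) →
      ∃ b : H, algebraMap H L b = algebraMap H L a / algebraMap H L z := by
    intro a z _ h
    have e : ι (algebraMap H _ a / algebraMap H _ z) = algebraMap H L a / algebraMap H L z := by
      simp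
    rw [← e, isIntegral_algHom_iff ι ι.injective] at h
    obtain ⟨b, hb⟩ := IsIntegrallyClosed.isIntegral_iff.mp h
    exact ⟨b, by rw [← e, ← hb, AlgHom.commutes]⟩
  have h_integral : Algebra.IsIntegral H S := inferInstance
  have hσ : Function.Injective ((IsScalarTower.toAlgHom H S L).comp (artinSchreierConj c)) :=
    hSL.comp (Function.LeftInverse.injective (artinSchreierConj_conj c))
  let σ : L →ₐ[H] L := IsFractionRing.liftAlgHom (K := L) hσ
  have hσS : ∀ y : S, σ (algebraMap S L y) = algebraMap S L (artinSchreierConj c y) := by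
    intro y
    exact IsFractionRing.lift_algebraMap hσ y
  refine (isIntegrallyClosed_iff L).mpr fun {x} hx => ?_
  have hxH : IsIntegral H x := isIntegral_trans x hx
  obtain ⟨y, w, hw, rfl⟩ := IsFractionRing.div_surjective (A := S) x
  have hw0 : w ≠ 0 := nonZeroDivisors.ne_zero hw
  have hw1 : artinSchreierConj c w ≠ 0 := fun h => hw0 (by
    rw [← artinSchreierConj_conj c w, h, map_zero])
  -- Multiplying through by the conjugate of w makes the denominator a norm, which lies in H.
  obtain ⟨z, hz⟩ := artinSchreier_mul_conj_mem c w
  have hz0 : z ≠ 0 := by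
    rintro rfl
    rw [map_zero] at hz
    exact mul_ne_zero hw0 hw1 hz
  obtain ⟨a, b, hab⟩ := artinSchreier_exists_eq c (y * artinSchreierConj c w)
  have hzL : algebraMap H L z ≠ 0 := fun h => hz0 (hHL (by rw [h, map_zero]))
  have tower : ∀ h : H, algebraMap S L (AdjoinRoot.of _ h) = algebraMap H L h := fun h =>
    (IsScalarTower.algebraMap_apply H S L h).symm
  have hxe : algebraMap S L y / algebraMap S L w =
      (algebraMap H L a + algebraMap H L b * algebraMap S L s) / algebraMap H L z := by
    rw [div_eq_div_iff (fun h => hw0 (hSL (by rw [h, map_zero]))) hzL, ← tower z, ← tower a,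
      ← tower b, ← hz, ← map_mul, ← map_mul, ← map_add, ← map_mul, ← hab]
    congr 1
    ring
  rw [hxe] at hxH ⊢
  have hσx : σ ((algebraMap H L a + algebraMap H L b * algebraMap S L s) / algebraMap H L z) =
      (algebraMap H L a + algebraMap H L b * (algebraMap S L s + 1)) / algebraMap H L z := by
    rw [map_div₀, map_add, map_mul, hσS, hs, artinSchreierConj_root, AlgHom.commutes,
      AlgHom.commutes, AlgHom.commutes, map_add, map_one]
  have hb := (hxH.map σ).add hxH
  rw [hσx, ← add_div] at hb
  obtain ⟨b', hb'⟩ := key b z hz0 (by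
    refine (congrArg (IsIntegral H) ?_).mp hb
    congr 1
    linear_combination (algebraMap H L a + algebraMap H L b * algebraMap S L s) * two)
  have hsint : IsIntegral H (algebraMap S L s) := (h_integral.isIntegral s).algebraMap
  have ha := hxH.sub ((isIntegral_algebraMap (x := b')).mul hsint)
  rw [hb'] at ha
  obtain ⟨a', ha'⟩ := key a z hz0 (by
    refine (congrArg (IsIntegral H) ?_).mp ha
    ring)
  refine ⟨AdjoinRoot.of _ a' + AdjoinRoot.of _ b' * s, ?_⟩
  rw [map_add, map_mul, tower, tower, ha', hb']
  ring

end ArtinSchreier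

/-! ### Pole orders normalized by t -/

section Pole

variable {F Γ : Type*} [Field F] [LinearOrderedCommGroupWithZero Γ] {v : Valuation F Γ}
  {t x y : F} {m n : ℤ}

/-- `x` has a pole of order `n` at the place `v`, where poles are measured so that `t` has a pole of
order `4`. -/
def HasPole (v : Valuation F Γ) (t x : F) (n : ℤ) : Prop := v x ^ 4 = v t ^ n

/-- `x` has a pole of order at most `n` at the place `v`, where poles are measured so that `t` has a
pole of order `4`. -/
def PoleLE (v : Valuation F Γ) (t x : F) (n : ℤ) : Prop := v x ^ 4 ≤ v t ^ n

theorem HasPole.poleLE (hx : HasPole v t x n) : PoleLE v t x n := le_of_eq hx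

theorem PoleLE.mono (ht : 1 < v t) (hx : PoleLE v t x m) (h : m ≤ n) : PoleLE v t x n :=
  hx.trans (zpow_le_zpow_right₀ ht.le h)

theorem PoleLE.zero : PoleLE v t 0 n := by
  simp [PoleLE]

theorem poleLE_zero_iff : PoleLE v t x 0 ↔ v x ≤ 1 := by
  simp [PoleLE, pow_le_one_iff]

theorem HasPole.ne_zero (ht : 1 < v t) (hx : HasPole v t x n) : x ≠ 0 := by
  rintro rfl
  have : v t ^ n ≠ 0 := zpow_ne_zero _ (zero_lt_one.trans ht).ne'
  simp only [HasPole, map_zero, ne_eq, OfNat.ofNat_ne_zero, not_false_eq_true, zero_pow] at hx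
  exact this hx.symm

theorem HasPole.mul (ht : 1 < v t) (hx : HasPole v t x m) (hy : HasPole v t y n) :
    HasPole v t (x * y) (m + n) := by
  rw [HasPole, map_mul, mul_pow, hx, hy, zpow_add₀ (zero_lt_one.trans ht).ne']

theorem HasPole.inv (hx : HasPole v t x n) : HasPole v t x⁻¹ (-n) := by
  rw [HasPole, map_inv₀, inv_pow, hx, zpow_neg]

theorem HasPole.div (ht : 1 < v t) (hx : HasPole v t x m) (hy : HasPole v t y n) :
    HasPole v t (x / y) (m - n) := by
  rw [div_eq_mul_inv, sub_eq_add_neg]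
  exact hx.mul ht hy.inv

theorem PoleLE.mul (ht : 1 < v t) (hx : PoleLE v t x m) (hy : PoleLE v t y n) :
    PoleLE v t (x * y) (m + n) := by
  rw [PoleLE, map_mul, mul_pow, zpow_add₀ (zero_lt_one.trans ht).ne']
  exact mul_le_mul' hx hy

theorem poleLE_iff (ht : 1 < v t) (hx : HasPole v t x m) : PoleLE v t x n ↔ m ≤ n := by
  rw [PoleLE, hx]
  exact zpow_le_zpow_iff_right₀ ht

theorem PoleLE.add (hx : PoleLE v t x n) (hy : PoleLE v t y n) : PoleLE v t (x + y) n := by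
  rcases le_max_iff.mp (v.map_add x y) with h | h
  · exact (pow_le_pow_left₀ zero_le h 4).trans hx
  · exact (pow_le_pow_left₀ zero_le h 4).trans hy

theorem PoleLE.sum {ι : Type*} {s : Finset ι} {f : ι → F} (h : ∀ i ∈ s, PoleLE v t (f i) n) :
    PoleLE v t (∑ i ∈ s, f i) n :=
  Finset.sum_induction f (fun x => PoleLE v t x n) (fun _ _ => PoleLE.add) .zero h

theorem PoleLE.neg (hx : PoleLE v t x n) : PoleLE v t (-x) n := by
  rwa [PoleLE, Valuation.map_neg]

theorem HasPole.lt (ht : 1 < v t) (hx : PoleLE v t x m) (hy : HasPole v t y n) (h : m < n) :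
    v x < v y := by
  refine lt_of_pow_lt_pow_left₀ 4 zero_le ?_
  rw [hy]
  exact hx.trans_lt (zpow_lt_zpow_right₀ ht h)

theorem HasPole.add_of_lt (ht : 1 < v t) (hx : PoleLE v t x m) (hy : HasPole v t y n)
    (h : m < n) : HasPole v t (x + y) n := by
  rw [HasPole, v.map_add_eq_of_lt_right (hy.lt ht hx h), hy]

theorem HasPole.eq_of_map_eq (ht : 1 < v t) (hx : HasPole v t x m) (hy : HasPole v t y n)
    (h : v x = v y) : m = n := by
  refine zpow_right_injective₀ (zero_lt_one.trans ht) ht.ne' ?_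
  change v t ^ m = v t ^ n
  rw [← hx, ← hy, h]

theorem HasPole.of_sq_add_self (ht : 1 < v t) (hn : 0 < n) (h : HasPole v t (x ^ 2 + x) (2 * n)) :
    HasPole v t x n := by
  have h1 : 1 < v x := by
    by_contra! hle
    have h2 : v (x ^ 2 + x) ≤ 1 :=
      v.map_add_le (by rw [map_pow]; exact pow_le_one₀ zero_le hle) hle
    rw [← poleLE_zero_iff (t := t), poleLE_iff ht h] at h2
    omega
  have h2 : v (x ^ 2 + x) = v x ^ 2 := by
    rw [v.map_add_eq_of_lt_left, map_pow]
    rw [map_pow]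
    exact lt_self_pow₀ h1 (by norm_num)
  rw [HasPole, h2, ← pow_mul, mul_comm 2 4, pow_mul, mul_comm 2 n, zpow_mul] at h
  exact (pow_left_inj₀ zero_le zero_le two_ne_zero).mp (by exact_mod_cast h)

/-- Nonzero terms of pairwise distinct valuation cannot cancel, so the sum has the valuation of its
largest term. -/
theorem valuation_le_map_sum {ι : Type*} [Fintype ι] (f : ι → F)
    (h : ∀ i j, i ≠ j → v (f i) = v (f j) → f i = 0) (i : ι) : v (f i) ≤ v (∑ j, f j) := by
  classical
  obtain ⟨j, -, hj⟩ := Finset.exists_max_image Finset.univ (fun i => v (f i)) ⟨i, Finset.mem_univ i⟩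
  by_cases h0 : f j = 0
  · have := hj i (Finset.mem_univ i)
    rw [h0, map_zero] at this
    exact this.trans zero_le
  rw [v.map_sum_eq_of_lt (Finset.mem_univ j) fun l hl => ?_]
  · exact hj i (Finset.mem_univ i)
  · refine lt_of_le_of_ne (hj l (Finset.mem_univ l)) fun hlj => h0 (h j l ?_ hlj.symm)
    rintro rfl
    simp at hl

end Pole

/-! ### Valuations trivial on k and places over t = ∞ -/

theorem isTrivialOn_of_mem {k F : Type*} [Field k] [Field F] [Algebra k F]
    (O : ValuationSubring F) (hO : ∀ c : k, algebraMap k F c ∈ O) :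
    O.valuation.IsTrivialOn k where
  eq_one c hc := by
    refine le_antisymm ((O.valuation_le_one_iff _).mpr (hO c)) ?_
    have h := (O.valuation_le_one_iff _).mpr (hO c⁻¹)
    rw [map_inv₀, map_inv₀] at h
    rwa [inv_le_one₀] at h
    rw [zero_lt_iff, Valuation.ne_zero_iff]
    exact (_root_.map_ne_zero _).mpr hc

section Polynomial

variable {k F Γ : Type*} [Field k] [Field F] [Algebra k F] [Algebra k[X] F] [IsScalarTower k k[X] F]
  [LinearOrderedCommGroupWithZero Γ] {v : Valuation F Γ} [v.IsTrivialOn k]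

theorem algebraMap_eq_aeval (f : k[X]) : algebraMap k[X] F f = aeval (algebraMap k[X] F X) f := by
  rw [aeval_algebraMap_apply, aeval_X_left_apply]

theorem hasPole_algebraMap (ht : 1 < v (algebraMap k[X] F X)) {f : k[X]} (hf : f ≠ 0) :
    HasPole v (algebraMap k[X] F X) (algebraMap k[X] F f) (4 * f.natDegree) := by
  rw [HasPole, algebraMap_eq_aeval,
    valuation_aeval_eq_valuation_X_pow_natDegree_of_one_lt_valuation_X _ ht hf, ← pow_mul,
    mul_comm]
  norm_cast

theorem poleLE_algebraMap (ht : 1 < v (algebraMap k[X] F X)) (f : k[X]) :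
    PoleLE v (algebraMap k[X] F X) (algebraMap k[X] F f) (4 * f.natDegree) := by
  by_cases hf : f = 0
  · rw [hf, map_zero]
    exact .zero
  · exact (hasPole_algebraMap ht hf).poleLE

theorem poleLE_algebraMap_derivative (ht : 1 < v (algebraMap k[X] F X)) (f : k[X]) :
    PoleLE v (algebraMap k[X] F X) (algebraMap k[X] F (derivative f)) (4 * f.natDegree - 4) := by
  by_cases hf : f.natDegree = 0
  · rw [derivative_of_natDegree_zero hf, map_zero]
    exact .zero
  · refine (poleLE_algebraMap ht _).mono ht ?_
    have := natDegree_derivative_lt hf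
    omega

/-- As t is transcendental, t⁻¹ is not a unit of k[t⁻¹], so some valuation ring containing k[t⁻¹]
has t⁻¹ in its maximal ideal. -/
theorem exists_valuationSubring_infinity (hinj : Function.Injective (algebraMap k[X] F)) :
    ∃ O : ValuationSubring F, (∀ c : k, algebraMap k F c ∈ O) ∧
      1 < O.valuation (algebraMap k[X] F X) := by
  set t := algebraMap k[X] F X with ht
  have ht0 : t ≠ 0 := fun h => X_ne_zero (hinj (by rw [← ht, h, map_zero]))
  have htr : Transcendental k t := by
    rw [transcendental_iff_injective]
    intro f g h
    exact hinj (by rw [algebraMap_eq_aeval, algebraMap_eq_aeval g]; exact h)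
  let S : Subring F := (aeval (R := k) t⁻¹).range.toSubring
  let u : S := ⟨t⁻¹, X, aeval_X _⟩
  obtain ⟨O, hO, hI⟩ := Ideal.image_subset_nonunits_valuationSubring (Ideal.span {u}) (by
    rw [Ne, Ideal.span_singleton_eq_top, isUnit_iff_exists_inv]
    rintro ⟨⟨_, f, rfl⟩, hf⟩
    have h1 : t⁻¹ * aeval t⁻¹ f = 1 := congrArg Subtype.val hf
    have h2 : ¬ IsAlgebraic k t⁻¹ := by rwa [IsAlgebraic.inv_iff]
    refine h2 ⟨X * f - 1, fun h => ?_, by simp [h1]⟩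
    have := congrArg (eval 0) h
    simp at this)
  refine ⟨O, fun c => hO ⟨C c, by simp⟩, ?_⟩
  have h3 : t⁻¹ ∈ O.nonunits := hI ⟨u, Ideal.mem_span_singleton_self u, rfl⟩
  rwa [ValuationSubring.mem_nonunits_iff, map_inv₀, inv_lt_one₀] at h3
  rwa [zero_lt_iff, Valuation.ne_zero_iff]

end Polynomial

/-! ### The reduced tower at infinity -/

section Tower

variable {k F Γ : Type*} [Field k] [Field F] [Algebra k F] [Algebra k[X] F] [IsScalarTower k k[X] F]

/-- `r` and `s` generate a tower of two Artin–Schreier extensions of `k(t)`, totally ramified at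
infinity, with the second equation in reduced form. -/
structure IsReducedTower (A p q : k[X]) (r s : F) : Prop where
  odd : Odd A.natDegree
  q_ne_zero : q ≠ 0
  lt : 2 * p.natDegree < 2 * q.natDegree + A.natDegree
  eq_r : r ^ 2 + r = algebraMap k[X] F A
  eq_s : s ^ 2 + s = algebraMap k[X] F p + algebraMap k[X] F q * r

/-- The basis `1, r, s, rs` of the tower. -/
def towerBasis (r s : F) : Fin 4 → F := ![1, r, s, r * s]

/-- The pole orders of `1, r, s, rs` at infinity. -/
def towerPole (A q : k[X]) : Fin 4 → ℕ :=
  ![0, 2 * A.natDegree, 2 * q.natDegree + A.natDegree,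
    2 * A.natDegree + (2 * q.natDegree + A.natDegree)]

variable [LinearOrderedCommGroupWithZero Γ] {v : Valuation F Γ} [v.IsTrivialOn k]
  {A p q : k[X]} {r s : F}

/-- For a odd the orders of 1 and r are 0 and 2 mod 4, while those of s and rs are odd and differ by
2a ≡ 2. -/
theorem towerPole_mod_injective (hA : Odd A.natDegree) {i j : Fin 4}
    (hij : towerPole A q i % 4 = towerPole A q j % 4) : i = j := by
  obtain ⟨a, ha⟩ := hA
  fin_cases i <;> fin_cases j <;> first | rfl | (simp [towerPole] at hij; omega)

theorem hasPole_root_of_sq_add_self (ht : 1 < v (algebraMap k[X] F X)) (hA : Odd A.natDegree)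
    (hr : r ^ 2 + r = algebraMap k[X] F A) :
    HasPole v (algebraMap k[X] F X) r (2 * A.natDegree) := by
  have hA0 : 0 < A.natDegree := hA.pos
  refine .of_sq_add_self ht (by omega) ?_
  rw [hr]
  convert hasPole_algebraMap ht (f := A) (by rintro rfl; simp at hA0) using 1
  ring

theorem hasPole_add_mul (ht : 1 < v (algebraMap k[X] F X)) (hA : Odd A.natDegree)
    (hr : r ^ 2 + r = algebraMap k[X] F A) (hq : q ≠ 0)
    (hpq : 2 * p.natDegree < 2 * q.natDegree + A.natDegree) :
    HasPole v (algebraMap k[X] F X) (algebraMap k[X] F p + algebraMap k[X] F q * r)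
      (2 * (2 * q.natDegree + A.natDegree)) := by
  refine .add_of_lt ht (poleLE_algebraMap ht p) ?_ (by omega : 4 * (p.natDegree : ℤ) < _)
  convert (hasPole_algebraMap ht hq).mul ht (hasPole_root_of_sq_add_self ht hA hr) using 1
  ring

namespace IsReducedTower

theorem hasPole_r (h : IsReducedTower A p q r s)
    (ht : 1 < v (algebraMap k[X] F X)) :
    HasPole v (algebraMap k[X] F X) r (2 * A.natDegree) :=
  hasPole_root_of_sq_add_self ht h.odd h.eq_r

theorem hasPole_s (h : IsReducedTower A p q r s)
    (ht : 1 < v (algebraMap k[X] F X)) :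
    HasPole v (algebraMap k[X] F X) s (2 * q.natDegree + A.natDegree) := by
  have := h.odd.pos
  refine .of_sq_add_self ht (by omega) ?_
  rw [h.eq_s]
  exact hasPole_add_mul ht h.odd h.eq_r h.q_ne_zero h.lt

theorem hasPole_basis (h : IsReducedTower A p q r s)
    (ht : 1 < v (algebraMap k[X] F X)) (i : Fin 4) :
    HasPole v (algebraMap k[X] F X) (towerBasis r s i) (towerPole A q i) := by
  fin_cases i
  · simp [towerBasis, towerPole, HasPole]
  · simpa [towerBasis, towerPole] using h.hasPole_r ht
  · simpa [towerBasis, towerPole] using h.hasPole_s ht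
  · simpa [towerBasis, towerPole] using (h.hasPole_r ht).mul ht (h.hasPole_s ht)

theorem hasPole_term (h : IsReducedTower A p q r s)
    (ht : 1 < v (algebraMap k[X] F X)) {f z : k[X]} (hf : f ≠ 0) (hz : z ≠ 0)
    (i : Fin 4) : HasPole v (algebraMap k[X] F X)
      (algebraMap k[X] F f / algebraMap k[X] F z * towerBasis r s i)
      (4 * f.natDegree - 4 * z.natDegree + towerPole A q i) :=
  ((hasPole_algebraMap ht hf).div ht (hasPole_algebraMap ht hz)).mul ht (h.hasPole_basis ht i)

/-- Coefficients in k(t) have orders divisible by 4, so the order of a nonzero term determines its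
index mod 4. Each term is thus bounded by the whole sum. -/
theorem le_map_sum (h : IsReducedTower A p q r s)
    (ht : 1 < v (algebraMap k[X] F X)) (f : Fin 4 → k[X]) {z : k[X]} (hz : z ≠ 0)
    (i : Fin 4) : v (algebraMap k[X] F (f i) / algebraMap k[X] F z * towerBasis r s i) ≤
      v (∑ j, algebraMap k[X] F (f j) / algebraMap k[X] F z * towerBasis r s j) := by
  refine valuation_le_map_sum (fun j => algebraMap k[X] F (f j) / algebraMap k[X] F z *
    towerBasis r s j) (fun i j hij hv => ?_) i
  by_cases hi : f i = 0
  · simp [hi]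
  by_cases hj : f j = 0
  · simpa [hj] using hv
  have := (h.hasPole_term ht hi hz i).eq_of_map_eq ht (h.hasPole_term ht hj hz j) hv
  exact absurd (towerPole_mod_injective (q := q) h.odd (by omega)) hij

theorem poleLE_sum_iff (h : IsReducedTower A p q r s)
    (ht : 1 < v (algebraMap k[X] F X)) (f : Fin 4 → k[X]) (N : ℤ) :
    PoleLE v (algebraMap k[X] F X) (∑ j, algebraMap k[X] F (f j) * towerBasis r s j) N ↔
      ∀ i, f i = 0 ∨ 4 * ((f i).natDegree : ℤ) + towerPole A q i ≤ N := by
  constructor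
  · intro hN i
    refine or_iff_not_imp_left.mpr fun hi => ?_
    have h1 := h.le_map_sum ht f one_ne_zero i
    have h2 := h.hasPole_term ht hi one_ne_zero i
    simp only [map_one, div_one] at h1 h2
    have := (poleLE_iff ht h2).mp ((pow_le_pow_left₀ zero_le h1 4).trans hN)
    simpa using this
  · intro hN
    refine .sum fun i _ => ?_
    rcases hN i with hi | hi
    · rw [hi, map_zero, zero_mul]
      exact .zero
    · exact ((poleLE_algebraMap ht _).mul ht (h.hasPole_basis ht i).poleLE).mono ht hi

theorem sum_eq_zero_iff (h : IsReducedTower A p q r s)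
    (hinj : Function.Injective (algebraMap k[X] F)) (f : Fin 4 → k[X]) :
    ∑ j, algebraMap k[X] F (f j) * towerBasis r s j = 0 ↔ f = 0 := by
  refine ⟨fun h0 => funext fun i => ?_, fun h0 => by simp [h0]⟩
  obtain ⟨O, hO, ht⟩ := exists_valuationSubring_infinity (k := k) hinj
  have := isTrivialOn_of_mem O hO
  have h1 := (h.poleLE_sum_iff ht f (-1)).mp (by rw [h0]; exact .zero) i
  rcases h1 with h1 | h1
  · exact h1
  · omega

end IsReducedTower

end Tower

/-! ### The derivation d/dt at infinity -/

section Derivation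

theorem derivation_sq_add_self {k F : Type*} [Field k] [Field F] [Algebra k F] [CharP k 2]
    {δ : Derivation k F F} (x : F) : δ (x ^ 2 + x) = δ x := by
  have : CharP F 2 := charP_of_injective_algebraMap (algebraMap k F).injective 2
  rw [map_add, Derivation.leibniz_pow, CharTwo.two_nsmul, zero_add]

variable {k F Γ : Type*} [Field k] [Field F] [Algebra k F] [Algebra k[X] F] [IsScalarTower k k[X] F]
  [LinearOrderedCommGroupWithZero Γ] {v : Valuation F Γ} [v.IsTrivialOn k]
  {A p q : k[X]} {r s : F} {δ : Derivation k F F}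

theorem derivation_algebraMap (hδ : δ (algebraMap k[X] F X) = 1) (f : k[X]) :
    δ (algebraMap k[X] F f) = algebraMap k[X] F (derivative f) := by
  rw [algebraMap_eq_aeval, Derivation.map_aeval, hδ, smul_eq_mul, mul_one, ← algebraMap_eq_aeval]

/-- Differentiating a power of t lowers the order by at least 4, so for l > -4 the term δx / t^j
dominates in the quotient rule. -/
theorem hasPole_derivation_div_pow (ht : 1 < v (algebraMap k[X] F X))
    (hδ : δ (algebraMap k[X] F X) = 1) {x : F} {n l : ℤ} (hx : HasPole v (algebraMap k[X] F X) x n)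
    (hl : -4 < l) (hδx : HasPole v (algebraMap k[X] F X) (δ x) (n + l)) (j : ℕ) :
    HasPole v (algebraMap k[X] F X) (δ (x / algebraMap k[X] F (X ^ j))) (n + l - 4 * j) := by
  have hX := hasPole_algebraMap (v := v) ht (f := X ^ j) (pow_ne_zero _ X_ne_zero)
  have hX' := poleLE_algebraMap_derivative (v := v) ht (X ^ j)
  rw [natDegree_X_pow] at hX hX'
  have hzF := hX.ne_zero ht
  have e : δ (x / algebraMap k[X] F (X ^ j)) =
      -(x * ((algebraMap k[X] F (X ^ j))⁻¹ * (algebraMap k[X] F (X ^ j))⁻¹) *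
        algebraMap k[X] F (derivative (X ^ j))) + δ x * (algebraMap k[X] F (X ^ j))⁻¹ := by
    rw [Derivation.leibniz_div, derivation_algebraMap hδ, smul_eq_mul, smul_eq_mul, smul_eq_mul]
    field_simp
    ring
  rw [e]
  refine .add_of_lt ht (m := n - 4 * j - 4) (.neg ?_) ?_ (by omega)
  · exact ((hx.poleLE.mul ht (hX.inv.mul ht hX.inv).poleLE).mul ht hX').mono ht (by omega)
  · exact hδx.mul ht hX.inv

variable [CharP k 2]

theorem hasPole_derivative_of_odd (ht : 1 < v (algebraMap k[X] F X)) (hA : Odd A.natDegree) :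
    HasPole v (algebraMap k[X] F X) (algebraMap k[X] F (derivative A)) (4 * A.natDegree - 4) := by
  obtain ⟨a, ha⟩ := hA
  have h0 : (derivative A).coeff (2 * a) ≠ 0 := by
    rw [coeff_derivative, ← ha, show ((2 * a : ℕ) : k) + 1 = 1 by
      simp [CharTwo.two_eq_zero], mul_one]
    refine leadingCoeff_ne_zero.mpr ?_
    rintro rfl
    simp at ha
  have h1 : (derivative A).natDegree = 2 * a := by
    refine le_antisymm ?_ (le_natDegree_of_ne_zero h0)
    have := natDegree_derivative_le A
    omega
  convert hasPole_algebraMap ht (f := derivative A) (by intro h; simp [h] at h0) using 1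
  omega

namespace IsReducedTower

theorem derivation_r (h : IsReducedTower A p q r s)
    (hδ : δ (algebraMap k[X] F X) = 1) :
    δ r = algebraMap k[X] F (derivative A) := by
  rw [← derivation_sq_add_self, h.eq_r, derivation_algebraMap hδ]

theorem derivation_s (h : IsReducedTower A p q r s)
    (hδ : δ (algebraMap k[X] F X) = 1) :
    δ s = algebraMap k[X] F (derivative p) + r * algebraMap k[X] F (derivative q) +
      algebraMap k[X] F q * algebraMap k[X] F (derivative A) := by
  rw [← derivation_sq_add_self, h.eq_s, map_add, Derivation.leibniz, derivation_algebraMap hδ,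
    derivation_algebraMap hδ, h.derivation_r hδ, smul_eq_mul, smul_eq_mul]
  ring

theorem hasPole_derivation_s (h : IsReducedTower A p q r s)
    (ht : 1 < v (algebraMap k[X] F X))
    (hδ : δ (algebraMap k[X] F X) = 1) :
    HasPole v (algebraMap k[X] F X) (δ s) (4 * q.natDegree + 4 * A.natDegree - 4) := by
  have h0 := h.lt
  have h1 := h.odd.pos
  rw [h.derivation_s hδ]
  refine .add_of_lt ht (m := 4 * q.natDegree + 2 * A.natDegree - 4) (.add ?_ ?_) ?_ (by omega)
  · exact (poleLE_algebraMap_derivative ht p).mono ht (by omega)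
  · exact ((h.hasPole_r ht).poleLE.mul ht (poleLE_algebraMap_derivative ht q)).mono ht (by omega)
  · convert (hasPole_algebraMap ht h.q_ne_zero).mul ht (hasPole_derivative_of_odd ht h.odd) using 1
    ring

theorem hasPole_derivation_rs (h : IsReducedTower A p q r s)
    (ht : 1 < v (algebraMap k[X] F X))
    (hδ : δ (algebraMap k[X] F X) = 1) :
    HasPole v (algebraMap k[X] F X) (δ (r * s)) (4 * q.natDegree + 6 * A.natDegree - 4) := by
  have h1 := h.odd.pos
  rw [Derivation.leibniz, smul_eq_mul, smul_eq_mul, h.derivation_r hδ, add_comm]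
  refine .add_of_lt ht (m := 2 * q.natDegree + 5 * A.natDegree - 4) ?_ ?_ (by omega)
  · exact ((h.hasPole_s ht).mul ht (hasPole_derivative_of_odd ht h.odd)).poleLE.mono ht (by omega)
  · convert (h.hasPole_r ht).mul ht (h.hasPole_derivation_s ht hδ) using 1
    ring

/-- Differentiation raises the order of a basis element by at most N + 1 = 2d + 3a - 4, with
equality for s and rs. -/
theorem poleLE_derivation_basis (h : IsReducedTower A p q r s)
    (ht : 1 < v (algebraMap k[X] F X))
    (hδ : δ (algebraMap k[X] F X) = 1) (i : Fin 4) :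
    PoleLE v (algebraMap k[X] F X) (δ (towerBasis r s i))
      (towerPole A q i + 2 * q.natDegree + 3 * A.natDegree - 4) := by
  fin_cases i
  · simp [towerBasis, PoleLE.zero]
  · simp only [towerBasis, towerPole, Fin.mk_one, Matrix.cons_val_one, Matrix.cons_val_zero]
    rw [h.derivation_r hδ]
    exact (hasPole_derivative_of_odd ht h.odd).poleLE.mono ht (by push_cast; omega)
  · simp only [towerBasis, towerPole, Fin.reduceFinMk, Matrix.cons_val]
    exact (h.hasPole_derivation_s ht hδ).poleLE.mono ht (by push_cast; omega)
  · simp only [towerBasis, towerPole, Fin.reduceFinMk, Matrix.cons_val]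
    exact (h.hasPole_derivation_rs ht hδ).poleLE.mono ht (by push_cast; omega)

theorem poleLE_derivation_term (h : IsReducedTower A p q r s)
    (ht : 1 < v (algebraMap k[X] F X))
    (hδ : δ (algebraMap k[X] F X) = 1) {f z : k[X]} (hz : z ≠ 0) (i : Fin 4)
    (hx : v (algebraMap k[X] F f / algebraMap k[X] F z * towerBasis r s i) ≤ 1) :
    PoleLE v (algebraMap k[X] F X)
      (δ (algebraMap k[X] F f / algebraMap k[X] F z * towerBasis r s i))
      (2 * q.natDegree + 3 * A.natDegree - 5) := by
  have h1 := h.odd.pos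
  by_cases hf : f = 0
  · simp [hf, PoleLE.zero]
  have hn := (poleLE_iff ht (h.hasPole_term ht hf hz i)).mp (poleLE_zero_iff.mpr hx)
  have hz' := hasPole_algebraMap (v := v) ht hz
  have hf' := hasPole_algebraMap (v := v) ht hf
  have hρ : PoleLE v (algebraMap k[X] F X) (δ (algebraMap k[X] F f / algebraMap k[X] F z))
      (4 * f.natDegree - 4 * z.natDegree - 4) := by
    have hzF : algebraMap k[X] F z ≠ 0 := hz'.ne_zero ht
    have e : δ (algebraMap k[X] F f / algebraMap k[X] F z) =
        algebraMap k[X] F (derivative f) * (algebraMap k[X] F z)⁻¹ +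
        -(algebraMap k[X] F f * ((algebraMap k[X] F z)⁻¹ * (algebraMap k[X] F z)⁻¹) *
          algebraMap k[X] F (derivative z)) := by
      rw [Derivation.leibniz_div, derivation_algebraMap hδ, derivation_algebraMap hδ,
        smul_eq_mul, smul_eq_mul, smul_eq_mul]
      field_simp
      ring
    rw [e]
    refine .add ?_ (.neg ?_)
    · exact ((poleLE_algebraMap_derivative ht f).mul ht hz'.inv.poleLE).mono ht (by omega)
    · exact ((hf'.poleLE.mul ht (hz'.inv.mul ht hz'.inv).poleLE).mul ht
        (poleLE_algebraMap_derivative ht z)).mono ht (by omega)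
  rw [Derivation.leibniz, smul_eq_mul, smul_eq_mul]
  refine .add ?_ ?_
  -- Order at most -1 turns the bound N + 1 into N. Order exactly 0 forces i = 0 mod 4, and then the
  -- basis element 1 has derivative 0.
  · by_cases hn0 : 4 * (f.natDegree : ℤ) - 4 * z.natDegree + towerPole A q i = 0
    · have hi : i = 0 := towerPole_mod_injective (q := q) h.odd (by
        have : towerPole A q 0 = 0 := rfl
        omega)
      subst hi
      simp [towerBasis, PoleLE.zero]
    · exact ((hf'.div ht hz').poleLE.mul ht (h.poleLE_derivation_basis ht hδ i)).mono ht (by omega)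
  · exact ((h.hasPole_basis ht i).poleLE.mul ht hρ).mono ht (by omega)

theorem poleLE_derivation (h : IsReducedTower A p q r s)
    (ht : 1 < v (algebraMap k[X] F X))
    (hδ : δ (algebraMap k[X] F X) = 1) (f : Fin 4 → k[X]) {z : k[X]} (hz : z ≠ 0)
    (hx : v (∑ j, algebraMap k[X] F (f j) / algebraMap k[X] F z * towerBasis r s j) ≤ 1) :
    PoleLE v (algebraMap k[X] F X)
      (δ (∑ j, algebraMap k[X] F (f j) / algebraMap k[X] F z * towerBasis r s j))
      (2 * q.natDegree + 3 * A.natDegree - 5) := by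
  rw [map_sum]
  exact .sum fun i _ => h.poleLE_derivation_term ht hδ hz i ((h.le_map_sum ht f hz i).trans hx)

/-- The witness π is a quotient of s or rs by a power of t having pole order -1, a uniformizer in
this normalization. Since δ raises the orders of s and rs by exactly N + 1, δπ has order N. -/
theorem exists_hasPole_derivation (h : IsReducedTower A p q r s)
    (ht : 1 < v (algebraMap k[X] F X))
    (hδ : δ (algebraMap k[X] F X) = 1) :
    ∃ π : F, v π ≤ 1 ∧ HasPole v (algebraMap k[X] F X) (δ π)
      (2 * q.natDegree + 3 * A.natDegree - 5) := by
  obtain ⟨a, ha⟩ := h.odd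
  have hX : ∀ j : ℕ, HasPole v (algebraMap k[X] F X) (algebraMap k[X] F (X ^ j)) (4 * j) := by
    intro j
    simpa using hasPole_algebraMap (v := v) ht (f := X ^ j) (pow_ne_zero _ X_ne_zero)
  -- The order 2d + 2a + 1 of s is -1 mod 4 exactly when d + a + 1 is even (here deg A = 2a + 1);
  -- otherwise the order of rs is.
  rcases Nat.even_or_odd' (q.natDegree + a + 1) with ⟨j, hj | hj⟩
  · refine ⟨s / algebraMap k[X] F (X ^ j), poleLE_zero_iff.mp
      (((h.hasPole_s ht).div ht (hX j)).poleLE.mono ht (by omega)), ?_⟩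
    convert hasPole_derivation_div_pow ht hδ (h.hasPole_s ht)
      (l := 2 * q.natDegree + 3 * A.natDegree - 4) (by omega) ?_ j using 1
    · omega
    · convert h.hasPole_derivation_s ht hδ using 1
      ring
  · refine ⟨r * s / algebraMap k[X] F (X ^ (j + a + 1)), poleLE_zero_iff.mp
      ((((h.hasPole_r ht).mul ht (h.hasPole_s ht)).div ht (hX _)).poleLE.mono ht (by omega)), ?_⟩
    convert hasPole_derivation_div_pow ht hδ ((h.hasPole_r ht).mul ht (h.hasPole_s ht))
      (l := 2 * q.natDegree + 3 * A.natDegree - 4) (by omega) ?_ (j + a + 1) using 1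
    · omega
    · convert h.hasPole_derivation_rs ht hδ using 1
      ring

end IsReducedTower

end Derivation

/-! ### Reducing the second equation modulo elements w² + w -/

section Reduction

variable {k H : Type*} [Field k] [PerfectField k] [CharP k 2] [CommRing H] [Algebra k[X] H]

theorem exists_sq_eq_of_perfect (c : k) : ∃ d, d ^ 2 = c := by
  have : PerfectRing k 2 := PerfectField.toPerfectRing 2
  exact surjective_frobenius k 2 c

/-- Top terms of B are removed one at a time until the degree is at most deg A. The clause on
`q.coeff n` records that a nonzero top term at even n survives as the top term of q. -/
theorem exists_artinSchreier_reduction_aux {A : k[X]} (hA : Odd A.natDegree) {r : H}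
    (hr : r ^ 2 + r = algebraMap k[X] H A) (n : ℕ) (B : k[X])
    (hB : B.natDegree ≤ A.natDegree + n) :
    ∃ w₀ w₁ p q : k[X], p.natDegree ≤ A.natDegree ∧ q.natDegree ≤ n ∧
      (Even n → 0 < n → q.coeff n = 0 → B.coeff (A.natDegree + n) = 0) ∧
      algebraMap k[X] H B + (algebraMap k[X] H w₀ + algebraMap k[X] H w₁ * r) ^ 2 +
        (algebraMap k[X] H w₀ + algebraMap k[X] H w₁ * r) =
        algebraMap k[X] H p + algebraMap k[X] H q * r := by
  have two : (2 : H) = 0 := by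
    have h := congrArg (algebraMap k[X] H) (CharTwo.two_eq_zero (R := k[X]))
    rwa [map_ofNat, map_zero] at h
  induction n generalizing B with
  | zero => exact ⟨0, 0, B, 0, hB, by simp, by simp, by simp⟩
  | succ n ih =>
    rcases Nat.even_or_odd' (n + 1) with ⟨j, hj | hj⟩
    -- The top term is cancelled by c² t^(2j) A = c² t^(2j) (r² + r). As (c t^j r)² is equivalent to
    -- c t^j r, this is traded for (c² t^(2j) + c t^j) r, which goes into q.
    · obtain ⟨c, hc⟩ := exists_sq_eq_of_perfect (B.coeff (A.natDegree + (n + 1)) / A.leadingCoeff)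
      have hA0 : A.leadingCoeff ≠ 0 := by
        rw [Ne, leadingCoeff_eq_zero]
        rintro rfl
        simp at hA
      obtain ⟨w₀, w₁, p, q, hp, hq, -, e⟩ := ih (B + C (c ^ 2) * X ^ (2 * j) * A) (by
        rw [natDegree_le_iff_coeff_eq_zero]
        intro N hN
        have hN' : A.coeff (N - 2 * j) =
            if N = A.natDegree + (n + 1) then A.leadingCoeff else 0 := by
          split_ifs with h
          · rw [leadingCoeff]
            congr 1
            omega
          · exact coeff_eq_zero_of_natDegree_lt (by omega)
        rw [coeff_add, mul_assoc, coeff_C_mul, coeff_X_pow_mul', if_pos (by omega), hN', hc]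
        split_ifs with h
        · rw [div_mul_cancel₀ _ hA0, h, CharTwo.add_self_eq_zero]
        · rw [mul_zero, add_zero]
          exact coeff_eq_zero_of_natDegree_lt (by omega))
      refine ⟨w₀, w₁ + C c * X ^ j, p, q + C (c ^ 2) * X ^ (2 * j) + C c * X ^ j, hp, ?_, ?_, ?_⟩
      · refine natDegree_add_le_of_degree_le (natDegree_add_le_of_degree_le (by omega) ?_) ?_
        · exact (natDegree_C_mul_X_pow_le _ _).trans (by omega)
        · exact (natDegree_C_mul_X_pow_le _ _).trans (by omega)
      · intro _ _ h0
        -- Since j < 2j = n + 1, only c² t^(2j) contributes in degree n + 1.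
        have hc0 : c ^ 2 = 0 := by
          rw [coeff_add, coeff_add, coeff_eq_zero_of_natDegree_lt (by omega : q.natDegree < n + 1),
            coeff_C_mul, coeff_C_mul, coeff_X_pow, coeff_X_pow, if_pos hj, if_neg (by omega)] at h0
          simpa using h0
        rw [hc, div_eq_zero_iff] at hc0
        exact hc0.resolve_right hA0
      · simp only [map_add, map_mul, map_pow] at e ⊢
        generalize algebraMap k[X] H (C c) = C' at e ⊢
        generalize algebraMap k[X] H X = t at e ⊢
        rw [pow_mul', ← hr] at *
        linear_combination e + (C' * t ^ j * r * (algebraMap k[X] H w₀ + algebraMap k[X] H w₁ * r) -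
          C' ^ 2 * (t ^ j) ^ 2 * r) * two
    -- The top degree is now even, and c² t^(2l) is equivalent to c t^l, of lower degree.
    · by_cases hE : Even (A.natDegree + (n + 1))
      · obtain ⟨l, hl⟩ := hE
        obtain ⟨c, hc⟩ := exists_sq_eq_of_perfect (B.coeff (A.natDegree + (n + 1)))
        obtain ⟨w₀, w₁, p, q, hp, hq, -, e⟩ := ih (B + C (c ^ 2) * X ^ (2 * l) + C c * X ^ l) (by
          rw [natDegree_le_iff_coeff_eq_zero]
          intro N hN
          rw [coeff_add, coeff_add, coeff_C_mul, coeff_C_mul, coeff_X_pow, coeff_X_pow,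
            if_neg (by omega : N ≠ l), hc]
          split_ifs with h
          · rw [show A.natDegree + (n + 1) = N by omega, mul_one, mul_zero, add_zero,
              CharTwo.add_self_eq_zero]
          · rw [coeff_eq_zero_of_natDegree_lt (by omega)]
            simp)
        refine ⟨w₀ + C c * X ^ l, w₁, p, q, hp, by omega, fun h => ?_, ?_⟩
        · obtain ⟨i, hi⟩ := h
          omega
        · simp only [map_add, map_mul, map_pow] at e ⊢
          rw [← e, pow_mul']
          linear_combination (algebraMap k[X] H (C c) * algebraMap k[X] H X ^ l *
            (algebraMap k[X] H w₀ + algebraMap k[X] H w₁ * r)) * two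
      · rw [Nat.not_even_iff_odd] at hE
        obtain ⟨i, hi⟩ := hA
        obtain ⟨l, hl⟩ := hE
        omega

theorem exists_artinSchreier_reduction {A B : k[X]} (hA : Odd A.natDegree) (hB : Odd B.natDegree)
    {r : H} (hr : r ^ 2 + r = algebraMap k[X] H A) :
    ∃ w₀ w₁ p q : k[X], q ≠ 0 ∧ 2 * p.natDegree < 2 * q.natDegree + A.natDegree ∧
      q.natDegree = max A.natDegree (B.natDegree - A.natDegree) ∧
      r * algebraMap k[X] H A + algebraMap k[X] H B +
        (algebraMap k[X] H w₀ + algebraMap k[X] H w₁ * r) ^ 2 +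
        (algebraMap k[X] H w₀ + algebraMap k[X] H w₁ * r) =
        algebraMap k[X] H p + algebraMap k[X] H q * r := by
  have hA0 := hA.pos
  obtain ⟨i, hi⟩ := id hA
  obtain ⟨j, hj⟩ := hB
  rcases le_or_gt B.natDegree A.natDegree with hle | hlt
  · refine ⟨0, 0, B, A, ?_, by omega, by omega, ?_⟩
    · rintro rfl
      simp at hA0
    · simp only [map_zero]
      ring
  · obtain ⟨w₀, w₁, p, q, hp, hq, hc, e⟩ := exists_artinSchreier_reduction_aux hA hr
      (B.natDegree - A.natDegree) B (by omega)
    have hqc : q.coeff (B.natDegree - A.natDegree) ≠ 0 := by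
      intro h
      have := hc ⟨j - i, by omega⟩ (by omega) h
      rw [Nat.add_sub_cancel' hlt.le, ← leadingCoeff, leadingCoeff_eq_zero] at this
      rw [this] at hj
      simp at hj
    have hqd : q.natDegree = B.natDegree - A.natDegree :=
      le_antisymm hq (le_natDegree_of_ne_zero hqc)
    -- deg A is odd and deg q = b - a is even, so the leading terms cannot cancel.
    have hd : (A + q).natDegree = max A.natDegree (B.natDegree - A.natDegree) := by
      rcases lt_or_gt_of_ne (by omega : A.natDegree ≠ q.natDegree) with h | h
      · rw [natDegree_add_eq_right_of_natDegree_lt h]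
        omega
      · rw [natDegree_add_eq_left_of_natDegree_lt h]
        omega
    refine ⟨w₀, w₁, p, A + q, ?_, by omega, hd, ?_⟩
    · intro h
      rw [h, natDegree_zero] at hd
      omega
    · rw [map_add]
      linear_combination e

end Reduction

/-! ### Differentials as multiples of dt -/

section Differentials

theorem isRegularAt_smul_D {k F : Type*} [Field k] [Field F] [Algebra k F]
    {O : ValuationSubring F} {x y : F} (hx : x ∈ O) (hy : y ∈ O) :
    IsRegularAt k F O (x • KaehlerDifferential.D k F y) :=
  Submodule.smul_mem _ (⟨x, hx⟩ : O.toSubring) (Submodule.subset_span ⟨y, hy, rfl⟩)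

variable {k F : Type*} [Field k] [Field F] [Algebra k F] [Algebra k[X] F] [IsScalarTower k k[X] F]
  [Algebra.FormallyEtale k[X] F]

variable (k F) in
/-- The trivialization of the module of differentials by `dt`. -/
def differentialEquiv : Ω[F⁄k] ≃ₗ[F] F :=
  (KaehlerDifferential.tensorKaehlerEquivOfFormallyEtale k k[X] F).symm ≪≫ₗ
    (LinearEquiv.baseChange k[X] F _ _ (KaehlerDifferential.polynomialEquiv k)) ≪≫ₗ
    TensorProduct.AlgebraTensorModule.rid k[X] F F

theorem differentialEquiv_D_algebraMap_X :
    differentialEquiv k F (KaehlerDifferential.D k F (algebraMap k[X] F X)) = 1 := by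
  simp [differentialEquiv, KaehlerDifferential.tensorKaehlerEquivOfFormallyEtale_symm_D_algebraMap]

variable (k F) in
/-- The derivation `d/dt`. -/
def derivationT : Derivation k F F :=
  (differentialEquiv k F).toLinearMap.compDer (KaehlerDifferential.D k F)

theorem derivationT_apply (x : F) :
    derivationT k F x = differentialEquiv k F (KaehlerDifferential.D k F x) := rfl

theorem derivationT_X : derivationT k F (algebraMap k[X] F X) = 1 :=
  differentialEquiv_D_algebraMap_X

theorem D_eq_derivationT_smul (x : F) : KaehlerDifferential.D k F x =
    derivationT k F x • KaehlerDifferential.D k F (algebraMap k[X] F X) := by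
  apply (differentialEquiv k F).injective
  rw [map_smul, differentialEquiv_D_algebraMap_X, smul_eq_mul, mul_one, derivationT_apply]

theorem differentialEquiv_smul (ω : Ω[F⁄k]) :
    differentialEquiv k F ω • KaehlerDifferential.D k F (algebraMap k[X] F X) = ω := by
  apply (differentialEquiv k F).injective
  rw [map_smul, differentialEquiv_D_algebraMap_X, smul_eq_mul, mul_one]

/-- Induction principle: the coefficient of dt in a differential regular at O lies in the O-module
generated by the derivatives of elements of O. -/
theorem differentialEquiv_of_isRegularAt {O : ValuationSubring F} {ω : Ω[F⁄k]}
    (hω : IsRegularAt k F O ω) (P : F → Prop) (h0 : P 0) (hadd : ∀ x y, P x → P y → P (x + y))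
    (hmul : ∀ x ∈ O, ∀ y, P y → P (x * y)) (hδ : ∀ x ∈ O, P (derivationT k F x)) :
    P (differentialEquiv k F ω) := by
  refine Submodule.span_induction (p := fun ω _ => P (differentialEquiv k F ω)) ?_ ?_ ?_ ?_ hω
  · rintro _ ⟨x, hx, rfl⟩
    exact hδ x hx
  · rwa [map_zero]
  · intro x y _ _ hx hy
    rw [map_add]
    exact hadd _ _ hx hy
  · intro a x _ hx
    have : differentialEquiv k F (a • x) = (a : F) * differentialEquiv k F x :=
      map_smul (differentialEquiv k F) (a : F) x
    rw [this]
    exact hmul _ a.2 _ hx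

end Differentials

/-! ### The space of regular differentials -/

section Regular

theorem IsReducedTower.basis_mem {k F : Type*} [Field k] [Field F] [Algebra k[X] F]
    {A p q : k[X]} {r s : F} (h : IsReducedTower A p q r s) {O : ValuationSubring F}
    (hO : ∀ f : k[X], algebraMap k[X] F f ∈ O) (i : Fin 4) : towerBasis r s i ∈ O := by
  have key : ∀ z : F, z ^ 2 + z ∈ O → z ∈ O := by
    intro z hz
    rw [← O.valuation_le_one_iff] at hz ⊢
    by_contra! hlt
    rw [Valuation.map_add_eq_of_lt_left, map_pow] at hz
    · exact absurd hz (not_le.mpr (one_lt_pow₀ hlt two_ne_zero))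
    · rw [map_pow]
      exact lt_self_pow₀ hlt (by norm_num)
  have hr : r ∈ O := key r (by rw [h.eq_r]; exact hO A)
  have hs : s ∈ O := key s (by rw [h.eq_s]; exact add_mem (hO p) (mul_mem (hO q) hr))
  fin_cases i
  · exact O.one_mem
  · exact hr
  · exact hs
  · exact mul_mem hr hs

/-- Truncated subtraction is harmless: for l < n both sides say f = 0. -/
theorem mem_degreeLT_div_four_iff {k : Type*} [Field k] {f : k[X]} {l n : ℕ} :
    f ∈ degreeLT k ((l - n) / 4) ↔ f = 0 ∨ 4 * (f.natDegree : ℤ) + n ≤ l - 4 := by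
  rw [mem_degreeLT]
  by_cases hf : f = 0
  · simp [hf]
  · rw [degree_eq_natDegree hf, Nat.cast_lt]
    simp only [hf, false_or]
    omega

variable {k F R : Type*} [Field k] [Field F] [Algebra k F] [Algebra k[X] F] [IsScalarTower k k[X] F]
  [Algebra.FormallyEtale k[X] F] [CommRing R] [IsDedekindDomain R] [Algebra R F]
  [IsFractionRing R F]

/-- If d/dt preserves R, the quotient rule shows that it preserves the localization at each prime.
So the coefficient of dt is integral at every prime of the Dedekind domain R, and hence lies in R.
-/
theorem differentialEquiv_mem_range {ω : Ω[F⁄k]} (hω : ω ∈ regularDifferentials k F)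
    (hk : ∀ c : k, algebraMap k F c ∈ (algebraMap R F).range)
    (hδ : ∀ y : R, derivationT k F (algebraMap R F y) ∈ (algebraMap R F).range) :
    differentialEquiv k F ω ∈ (algebraMap R F).range := by
  refine IsDedekindDomain.HeightOneSpectrum.mem_integers_of_valuation_le_one F _ fun v => ?_
  have hv : ∀ x ∈ (algebraMap R F).range, v.valuation F x ≤ 1 := by
    rintro _ ⟨y, rfl⟩
    exact v.valuation_le_one y
  refine differentialEquiv_of_isRegularAt (hω (v.valuation F).valuationSubring fun c => hv _ (hk c))
    (fun x => v.valuation F x ≤ 1) (by simp) (fun x y hx hy => Valuation.map_add_le _ hx hy)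
    (fun x hx y hy => by
      rw [map_mul]
      exact mul_le_one' hx hy) fun x hx => ?_
  obtain ⟨n, d, hnd⟩ := v.exists_primeCompl_mul_eq_of_integer x hx
  have hd : v.valuation F (algebraMap R F d) = 1 := v.valuation_eq_one_iff_notMem.mpr d.2
  have e := congrArg (derivationT k F) hnd
  rw [Derivation.leibniz, smul_eq_mul, smul_eq_mul] at e
  have e' : algebraMap R F d * derivationT k F x =
      derivationT k F (algebraMap R F n) - x * derivationT k F (algebraMap R F d) := by
    rw [← e]
    ring
  have := congrArg (v.valuation F) e'
  rw [map_mul, hd, one_mul] at this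
  rw [this]
  refine Valuation.map_sub_le _ (hv _ (hδ n)) ?_
  rw [map_mul]
  exact mul_le_one' hx (hv _ (hδ d))

variable [CharP k 2] {A p q : k[X]} {r s : F}

theorem IsReducedTower.smul_D_mem (h : IsReducedTower A p q r s) (f : Fin 4 → k[X])
    (hf : ∀ i, f i = 0 ∨ 4 * ((f i).natDegree : ℤ) + towerPole A q i ≤
      2 * q.natDegree + 3 * A.natDegree - 5) :
    (∑ j, algebraMap k[X] F (f j) * towerBasis r s j) •
      KaehlerDifferential.D k F (algebraMap k[X] F X) ∈ regularDifferentials k F := by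
  intro O hO
  have := isTrivialOn_of_mem O hO
  by_cases ht : algebraMap k[X] F X ∈ O
  · have hO' : ∀ f : k[X], algebraMap k[X] F f ∈ O := by
      intro f
      rw [algebraMap_eq_aeval, aeval_eq_sum_range]
      refine sum_mem fun i _ => ?_
      rw [Algebra.smul_def]
      exact mul_mem (hO _) (pow_mem ht i)
    exact isRegularAt_smul_D (sum_mem fun j _ => mul_mem (hO' _) (h.basis_mem hO' j)) ht
  · rw [← O.valuation_le_one_iff, not_le] at ht
    obtain ⟨π, hπ, hδπ⟩ := h.exists_hasPole_derivation ht (derivationT_X (k := k) (F := F))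
    have hπ0 := hδπ.ne_zero ht
    -- Here f dt = (f / δπ) dπ, and f / δπ is integral because δπ has pole order exactly N.
    rw [← div_mul_cancel₀ (∑ j, algebraMap k[X] F (f j) * towerBasis r s j) hπ0, mul_smul,
      ← D_eq_derivationT_smul]
    refine isRegularAt_smul_D ?_ ((O.valuation_le_one_iff π).mp hπ)
    rw [← O.valuation_le_one_iff, ← poleLE_zero_iff (t := algebraMap k[X] F X), div_eq_mul_inv]
    exact (((h.poleLE_sum_iff ht f _).mpr hf).mul ht hδπ.inv.poleLE).mono ht (by omega)

theorem IsReducedTower.poleLE_differentialEquiv (h : IsReducedTower A p q r s)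
    (hF : ∀ x : F, ∃ (f : Fin 4 → k[X]) (z : k[X]), z ≠ 0 ∧
      x = ∑ j, algebraMap k[X] F (f j) / algebraMap k[X] F z * towerBasis r s j)
    {O : ValuationSubring F} (hO : ∀ c : k, algebraMap k F c ∈ O)
    (ht : 1 < O.valuation (algebraMap k[X] F X)) {ω : Ω[F⁄k]}
    (hω : ω ∈ regularDifferentials k F) :
    PoleLE O.valuation (algebraMap k[X] F X) (differentialEquiv k F ω)
      (2 * q.natDegree + 3 * A.natDegree - 5) := by
  have := isTrivialOn_of_mem O hO
  refine differentialEquiv_of_isRegularAt (hω O hO)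
    (fun x => PoleLE O.valuation (algebraMap k[X] F X) x _) .zero (fun x y => PoleLE.add)
    (fun x hx y hy => ?_) fun x hx => ?_
  · exact ((poleLE_zero_iff.mpr ((O.valuation_le_one_iff x).mpr hx)).mul ht hy).mono ht (by omega)
  · obtain ⟨f, z, hz, rfl⟩ := hF x
    exact h.poleLE_derivation ht derivationT_X f hz ((O.valuation_le_one_iff _).mpr hx)

/-- The regular differentials attached to the coefficients of `1, r, s, rs`. -/
def towerDifferential (r s : F) (n : Fin 4 → ℕ) : (∀ i, degreeLT k (n i)) →ₗ[k] Ω[F⁄k] where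
  toFun f := (∑ j, algebraMap k[X] F (f j) * towerBasis r s j) •
    KaehlerDifferential.D k F (algebraMap k[X] F X)
  map_add' f g := by
    simp only [Pi.add_apply, Submodule.coe_add, map_add, add_mul, Finset.sum_add_distrib, add_smul]
  map_smul' c f := by
    simp only [Pi.smul_apply, Submodule.coe_smul, RingHom.id_apply]
    rw [← smul_assoc, Finset.smul_sum]
    congr 1
    refine Finset.sum_congr rfl fun j _ => ?_
    rw [← algebraMap_smul k[X] c (f j : k[X]), smul_eq_mul, map_mul, mul_assoc,
      ← IsScalarTower.algebraMap_apply, Algebra.smul_def]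

theorem IsReducedTower.genus_eq (h : IsReducedTower A p q r s)
    (hinj : Function.Injective (algebraMap k[X] F))
    (hR : ∀ x : F, x ∈ (algebraMap R F).range ↔
      ∃ f : Fin 4 → k[X], x = ∑ j, algebraMap k[X] F (f j) * towerBasis r s j)
    (hF : ∀ x : F, ∃ (f : Fin 4 → k[X]) (z : k[X]), z ≠ 0 ∧
      x = ∑ j, algebraMap k[X] F (f j) / algebraMap k[X] F z * towerBasis r s j) :
    genus k F = ∑ i, (2 * q.natDegree + 3 * A.natDegree - 1 - towerPole A q i) / 4 := by
  have hA := h.odd.pos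
  -- The constant is N + 4: the i-th coefficient is zero or satisfies 4 deg + (order of the i-th
  -- basis element) ≤ N.
  set n : Fin 4 → ℕ := fun i => (2 * q.natDegree + 3 * A.natDegree - 1 - towerPole A q i) / 4
    with hn
  have hmem : ∀ (f : k[X]) (i : Fin 4), f ∈ degreeLT k (n i) ↔
      f = 0 ∨ 4 * (f.natDegree : ℤ) + towerPole A q i ≤
        2 * q.natDegree + 3 * A.natDegree - 5 := by
    intro f i
    rw [hn, mem_degreeLT_div_four_iff]
    refine or_congr_right ?_
    omega
  have hbasis : ∀ i, towerBasis r s i ∈ (algebraMap R F).range := fun i => (hR _).mpr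
    ⟨Pi.single i 1, by simp [Pi.single_apply, apply_ite (algebraMap k[X] F)]⟩
  have hpoly : ∀ f, algebraMap k[X] F f ∈ (algebraMap R F).range := fun f => (hR _).mpr
    ⟨Pi.single 0 f, by simp [Pi.single_apply, apply_ite (algebraMap k[X] F), towerBasis]⟩
  have hδpoly : ∀ f, derivationT k F (algebraMap k[X] F f) ∈ (algebraMap R F).range := fun f => by
    rw [derivation_algebraMap derivationT_X]
    exact hpoly _
  have hr : r ∈ (algebraMap R F).range := hbasis 1
  have hs : s ∈ (algebraMap R F).range := hbasis 2
  have hδr : derivationT k F r ∈ (algebraMap R F).range := by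
    rw [h.derivation_r derivationT_X]
    exact hpoly _
  have hδs : derivationT k F s ∈ (algebraMap R F).range := by
    rw [h.derivation_s derivationT_X]
    exact add_mem (add_mem (hpoly _) (mul_mem hr (hpoly _))) (mul_mem (hpoly _) (hpoly _))
  have hδbasis : ∀ i, derivationT k F (towerBasis r s i) ∈ (algebraMap R F).range := by
    intro i
    fin_cases i
    · simp [towerBasis]
    · exact hδr
    · exact hδs
    · change derivationT k F (r * s) ∈ _
      rw [Derivation.leibniz]
      exact add_mem (mul_mem hr hδs) (mul_mem hs hδr)
  have hδR : ∀ y : R, derivationT k F (algebraMap R F y) ∈ (algebraMap R F).range := by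
    intro y
    obtain ⟨f, hf⟩ := (hR _).mp ⟨y, rfl⟩
    rw [hf, map_sum]
    refine sum_mem fun j _ => ?_
    rw [Derivation.leibniz]
    exact add_mem (mul_mem (hpoly _) (hδbasis j)) (mul_mem (hbasis j) (hδpoly _))
  have hk : ∀ c : k, algebraMap k F c ∈ (algebraMap R F).range := fun c => by
    rw [IsScalarTower.algebraMap_apply k k[X] F]
    exact hpoly _
  have hrange : LinearMap.range (towerDifferential r s n) = regularDifferentials k F := by
    ext ω
    constructor
    · rintro ⟨f, rfl⟩
      exact h.smul_D_mem (fun i => (f i : k[X])) fun i => (hmem _ i).mp (f i).2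
    · intro hω
      obtain ⟨f, hf⟩ := (hR _).mp (differentialEquiv_mem_range hω hk hδR)
      obtain ⟨O, hO, ht⟩ := exists_valuationSubring_infinity (k := k) hinj
      have := isTrivialOn_of_mem O hO
      have hp := h.poleLE_differentialEquiv hF hO ht hω
      rw [hf] at hp
      refine ⟨fun i => ⟨f i, (hmem _ i).mpr ((h.poleLE_sum_iff ht f _).mp hp i)⟩, ?_⟩
      change (∑ j, algebraMap k[X] F (f j) * towerBasis r s j) • _ = ω
      rw [← hf, differentialEquiv_smul]
  have hker : Function.Injective (towerDifferential (k := k) r s n) := by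
    rw [injective_iff_map_eq_zero]
    intro f hf
    have h0 : (∑ j, algebraMap k[X] F (f j) * towerBasis r s j) •
        KaehlerDifferential.D k F (algebraMap k[X] F X) = 0 := hf
    have h1 := congrArg (differentialEquiv k F) h0
    rw [map_smul, differentialEquiv_D_algebraMap_X, smul_eq_mul, mul_one, map_zero,
      h.sum_eq_zero_iff hinj] at h1
    funext i
    exact Subtype.ext (congrFun h1 i)
  have hfin : ∀ m, Module.Finite k (degreeLT k m) := fun m =>
    Module.Finite.equiv (degreeLTEquiv k m).symm
  rw [genus, ← hrange, LinearMap.finrank_range_of_inj hker, Module.finrank_pi_fintype]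
  refine Finset.sum_congr rfl fun i _ => ?_
  rw [(degreeLTEquiv k (n i)).finrank_eq, Module.finrank_fin_fun]

end Regular

/-! ### Integrality, normality and étaleness of the curve -/

section Curve

variable {k : Type*} [Field k] {A : k[X]}

theorem HasPole.not_div_odd {F Γ : Type*} [Field F] [LinearOrderedCommGroupWithZero Γ]
    {v : Valuation F Γ} {t x y : F} (ht : 1 < v t) {l m n : ℤ} (hx : HasPole v t x (2 * m))
    (hy : HasPole v t y (2 * n)) : ¬ HasPole v t (x / y) (2 * l + 1) := by
  intro h
  have := (hx.div ht hy).eq_of_map_eq ht h rfl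
  omega

/-- A root would have order 2a ≡ 2 mod 4 at infinity, but rational functions of t have orders
divisible by 4. -/
theorem sq_add_self_ne_of_odd (hA : Odd A.natDegree) (z : FractionRing k[X]) :
    z ^ 2 + z ≠ algebraMap k[X] (FractionRing k[X]) A := by
  intro hz
  obtain ⟨O, hO, ht⟩ := exists_valuationSubring_infinity (k := k)
    (IsFractionRing.injective k[X] (FractionRing k[X]))
  have := isTrivialOn_of_mem O hO
  have h1 := hasPole_root_of_sq_add_self ht hA hz
  have hz0 := h1.ne_zero ht
  obtain ⟨f, g, hg, rfl⟩ := IsFractionRing.div_surjective (A := k[X]) z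
  have hg0 := nonZeroDivisors.ne_zero hg
  have hf0 : f ≠ 0 := by
    rintro rfl
    simp at hz0
  have h2 := (hasPole_algebraMap ht hf0).div ht (hasPole_algebraMap (v := O.valuation) ht hg0)
  have h3 := h1.eq_of_map_eq ht h2 rfl
  obtain ⟨a, ha⟩ := hA
  omega

theorem isDomain_coordRingH (hA : Odd A.natDegree) : IsDomain (CoordRingH A) :=
  AdjoinRoot.isDomain_of_prime
    (artinSchreier_prime (K := FractionRing k[X]) A (sq_add_self_ne_of_odd hA))

theorem algebraMap_coordRingH_injective :
    Function.Injective (algebraMap k[X] (CoordRingH A)) :=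
  artinSchreier_of_injective A

/-- In f + g r the two terms have orders 0 and 2 mod 4, so one of them dominates. Odd orders are
thereby excluded in k(t, r). -/
theorem exists_hasPole_coordRingH {F Γ : Type*} [Field F] [Algebra k F] [Algebra k[X] F]
    [IsScalarTower k k[X] F] [Algebra (CoordRingH A) F] [IsScalarTower k[X] (CoordRingH A) F]
    [LinearOrderedCommGroupWithZero Γ] {v : Valuation F Γ} [v.IsTrivialOn k]
    (ht : 1 < v (algebraMap k[X] F X)) (hA : Odd A.natDegree) {y : CoordRingH A}
    (hy : algebraMap (CoordRingH A) F y ≠ 0) :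
    ∃ n : ℤ, HasPole v (algebraMap k[X] F X) (algebraMap (CoordRingH A) F y) (2 * n) := by
  obtain ⟨f, g, rfl⟩ := artinSchreier_exists_eq A y
  have tower : ∀ f : k[X], algebraMap (CoordRingH A) F (AdjoinRoot.of _ f) = algebraMap k[X] F f :=
    fun f => (IsScalarTower.algebraMap_apply k[X] (CoordRingH A) F f).symm
  rw [map_add, map_mul, tower, tower] at hy ⊢
  have hr : HasPole v (algebraMap k[X] F X) (algebraMap (CoordRingH A) F (r A))
      (2 * A.natDegree) := by
    refine hasPole_root_of_sq_add_self ht hA ?_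
    rw [← map_pow, ← map_add, ← tower, artinSchreier_root]
  by_cases hg : g = 0
  · rw [hg] at hy ⊢
    have hf : f ≠ 0 := by
      rintro rfl
      simp at hy
    refine ⟨2 * f.natDegree, ?_⟩
    convert hasPole_algebraMap (v := v) ht hf using 1
    · simp
    · ring
  have hgr := (hasPole_algebraMap (v := v) ht hg).mul ht hr
  by_cases hf : f = 0
  · refine ⟨2 * g.natDegree + A.natDegree, ?_⟩
    rw [hf]
    convert hgr using 1
    · simp
    · ring
  have hff := hasPole_algebraMap (v := v) ht hf
  obtain ⟨a, ha⟩ := hA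
  rcases lt_or_gt_of_ne (by omega : 4 * (f.natDegree : ℤ) ≠ 4 * g.natDegree + 2 * A.natDegree)
    with h | h
  · refine ⟨2 * g.natDegree + A.natDegree, ?_⟩
    convert HasPole.add_of_lt ht hff.poleLE hgr h using 1
    ring
  · refine ⟨2 * f.natDegree, ?_⟩
    rw [add_comm]
    convert HasPole.add_of_lt ht hgr.poleLE hff h using 1
    ring

variable [CharP k 2] {B : k[X]}

/-- After translation by w, a root solves the reduced equation and has odd order 2d + a, impossible
in k(t, r). -/
theorem sq_add_self_ne_coordRingH [PerfectField k] (hA : Odd A.natDegree) (hB : Odd B.natDegree)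
    [IsDomain (CoordRingH A)] (z : FractionRing (CoordRingH A)) :
    z ^ 2 + z ≠ algebraMap (CoordRingH A) _ (r A * AdjoinRoot.of _ A + AdjoinRoot.of _ B) := by
  intro hz
  let K := FractionRing (CoordRingH A)
  have hinj : Function.Injective (algebraMap k[X] K) := by
    rw [IsScalarTower.algebraMap_eq k[X] (CoordRingH A) K]
    exact (IsFractionRing.injective (CoordRingH A) K).comp algebraMap_coordRingH_injective
  obtain ⟨O, hO, ht⟩ := exists_valuationSubring_infinity (k := k) hinj
  have := isTrivialOn_of_mem O hO
  have hr : algebraMap (CoordRingH A) K (r A) ^ 2 + algebraMap (CoordRingH A) K (r A) =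
      algebraMap k[X] K A := by
    rw [← map_pow, ← map_add, artinSchreier_root,
      IsScalarTower.algebraMap_apply k[X] (CoordRingH A)]
    rfl
  have two : (2 : K) = 0 := by
    have h := congrArg (algebraMap k[X] K) (CharTwo.two_eq_zero (R := k[X]))
    rwa [map_ofNat, map_zero] at h
  obtain ⟨w₀, w₁, p, q, hq, hpq, -, e⟩ := exists_artinSchreier_reduction hA hB hr
  set w := algebraMap k[X] K w₀ + algebraMap k[X] K w₁ * algebraMap (CoordRingH A) K (r A)
  have hz' : (z + w) ^ 2 + (z + w) = algebraMap k[X] K p +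
      algebraMap k[X] K q * algebraMap (CoordRingH A) K (r A) := by
    rw [map_add, map_mul] at hz
    change z ^ 2 + z = algebraMap (CoordRingH A) K (r A) *
      algebraMap (CoordRingH A) K (algebraMap k[X] (CoordRingH A) A) +
      algebraMap (CoordRingH A) K (algebraMap k[X] (CoordRingH A) B) at hz
    rw [← IsScalarTower.algebraMap_apply, ← IsScalarTower.algebraMap_apply] at hz
    linear_combination hz + e + z * w * two
  have hA0 := hA.pos
  have h1 : HasPole O.valuation (algebraMap k[X] K X) (z + w)
      (2 * q.natDegree + A.natDegree) := by
    refine .of_sq_add_self ht (by omega) ?_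
    rw [hz']
    exact hasPole_add_mul ht hA hr hq hpq
  have hne := h1.ne_zero ht
  obtain ⟨y, u, hu, hyu⟩ := IsFractionRing.div_surjective (A := CoordRingH A) (z + w)
  rw [← hyu] at h1 hne
  obtain ⟨m, hm⟩ := exists_hasPole_coordRingH (v := O.valuation) ht hA (left_ne_zero_of_mul
    (a := algebraMap (CoordRingH A) K y) (b := (algebraMap (CoordRingH A) K u)⁻¹)
    (by rwa [← div_eq_mul_inv]))
  obtain ⟨n, hn⟩ := exists_hasPole_coordRingH (v := O.valuation) ht hA
    (y := u) (F := K) (IsFractionRing.to_map_ne_zero_of_mem_nonZeroDivisors hu)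
  obtain ⟨a, ha⟩ := hA
  refine HasPole.not_div_odd ht hm hn (l := q.natDegree + a) ?_
  convert h1 using 1
  omega

theorem isDomain_coordRingC [PerfectField k] (hA : Odd A.natDegree) (hB : Odd B.natDegree) :
    IsDomain (CoordRingC A B) := by
  have := isDomain_coordRingH hA
  exact AdjoinRoot.isDomain_of_prime (artinSchreier_prime (K := FractionRing (CoordRingH A)) _
    (sq_add_self_ne_coordRingH hA hB))

instance : Module.Finite k[X] (CoordRingC A B) :=
  Module.Finite.trans (CoordRingH A) _

theorem isDedekindDomain_coordRingC (hA : Odd A.natDegree) [IsDomain (CoordRingC A B)] :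
    IsDedekindDomain (CoordRingC A B) := by
  have := isDomain_coordRingH hA
  have : IsIntegrallyClosed (CoordRingH A) := artinSchreier_isIntegrallyClosed A
  have : CharP (CoordRingH A) 2 := artinSchreier_charP A
  have : IsIntegrallyClosed (CoordRingC A B) := artinSchreier_isIntegrallyClosed _
  have : IsNoetherianRing (CoordRingC A B) := IsNoetherianRing.of_finite k[X] _
  have : Algebra.IsIntegral k[X] (CoordRingC A B) := inferInstance
  have : Ring.DimensionLEOne (CoordRingC A B) := Ring.DimensionLEOne.of_isIntegral k[X] _
  exact { }

theorem formallyEtale_fractionRing (hA : Odd A.natDegree) [IsDomain (CoordRingC A B)] :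
    Algebra.FormallyEtale k[X] (FractionRing (CoordRingC A B)) := by
  have := isDomain_coordRingH hA
  have : CharP (CoordRingH A) 2 := artinSchreier_charP A
  have h1 : Algebra.FormallyEtale (CoordRingH A) (CoordRingC A B) := inferInstance
  have h2 : Algebra.FormallyEtale k[X] (CoordRingC A B) := .comp k[X] (CoordRingH A) _
  have h3 : Algebra.FormallyEtale (CoordRingC A B) (FractionRing (CoordRingC A B)) :=
    .of_isLocalization (nonZeroDivisors (CoordRingC A B))
  exact .comp k[X] (CoordRingC A B) _

end Curve

/-! ### Computation of the genus -/

section Genus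

variable {k : Type*} [Field k] {A B : k[X]}

theorem exists_algebraMap_mul_eq (P R F : Type*) [CommRing P] [IsDomain P] [CommRing R] [IsDomain R]
    [IsIntegrallyClosed R] [Field F] [Algebra P R] [Algebra.IsIntegral P R] [Algebra R F]
    [IsFractionRing R F] [Algebra P F] [IsScalarTower P R F] (x : F) :
    ∃ (y : R) (z : P), z ≠ 0 ∧ algebraMap P F z * x = algebraMap R F y := by
  have := IsLocalization.isAlgebraic F (nonZeroDivisors R)
  have h : Algebra.IsAlgebraic P F := Algebra.IsAlgebraic.trans P R F
  obtain ⟨z, hz, h_integral⟩ := (h.isAlgebraic x).exists_integral_multiple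
  obtain ⟨y, hy⟩ := IsIntegrallyClosed.isIntegral_iff.mp (h_integral.tower_top (A := R))
  exact ⟨y, z, hz, by rw [hy, Algebra.smul_def]⟩

theorem exists_genus_eq_of_generators {R F : Type*} [Field F] [CommRing R] [Algebra k F]
    [Algebra k[X] F] [IsScalarTower k k[X] F] [Algebra.FormallyEtale k[X] F] [IsDedekindDomain R]
    [Algebra R F] [IsFractionRing R F] [Algebra k[X] R] [Algebra.IsIntegral k[X] R]
    [IsScalarTower k[X] R F] [CharP k 2] [PerfectField k] (hA : Odd A.natDegree)
    (hB : Odd B.natDegree) (hinj : Function.Injective (algebraMap k[X] F)) {ρ σ : R}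
    (hρ : ρ ^ 2 + ρ = algebraMap k[X] R A)
    (hσ : σ ^ 2 + σ = ρ * algebraMap k[X] R A + algebraMap k[X] R B)
    (hgen : ∀ y : R, ∃ f₀ f₁ g₀ g₁ : k[X], y = algebraMap k[X] R f₀ + algebraMap k[X] R f₁ * ρ +
      (algebraMap k[X] R g₀ + algebraMap k[X] R g₁ * ρ) * σ) :
    ∃ q : k[X], q.natDegree = max A.natDegree (B.natDegree - A.natDegree) ∧
      genus k F = ∑ i, (2 * q.natDegree + 3 * A.natDegree - 1 - towerPole A q i) / 4 := by
  have two : (2 : R) = 0 := by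
    have h := congrArg (algebraMap k[X] R) (CharTwo.two_eq_zero (R := k[X]))
    rwa [map_ofNat, map_zero] at h
  have tower : ∀ f : k[X], algebraMap R F (algebraMap k[X] R f) = algebraMap k[X] F f :=
    fun f => (IsScalarTower.algebraMap_apply k[X] R F f).symm
  obtain ⟨w₀, w₁, p, q, hq, hpq, hd, e⟩ := exists_artinSchreier_reduction hA hB hρ
  obtain ⟨s, hs⟩ : ∃ s, s = σ + (algebraMap k[X] R w₀ + algebraMap k[X] R w₁ * ρ) := ⟨_, rfl⟩
  have heq : s ^ 2 + s = algebraMap k[X] R p + algebraMap k[X] R q * ρ := by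
    rw [hs]
    linear_combination e + hσ +
      σ * (algebraMap k[X] R w₀ + algebraMap k[X] R w₁ * ρ) * two
  have ht : IsReducedTower A p q (algebraMap R F ρ) (algebraMap R F s) := by
    refine ⟨hA, hq, hpq, ?_, ?_⟩
    · rw [← tower, ← hρ, map_add, map_pow]
    · rw [← tower, ← tower, ← map_mul, ← map_add, ← heq, map_add, map_pow]
  have hR : ∀ x : F, x ∈ (algebraMap R F).range ↔ ∃ f : Fin 4 → k[X],
      x = ∑ j, algebraMap k[X] F (f j) * towerBasis (algebraMap R F ρ) (algebraMap R F s) j := by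
    intro x
    constructor
    · rintro ⟨y, rfl⟩
      obtain ⟨f₀, f₁, g₀, g₁, rfl⟩ := hgen y
      -- Coefficients obtained by substituting σ = s - w₀ - w₁ ρ and ρ² = A - ρ.
      refine ⟨![f₀ - g₀ * w₀ - g₁ * w₁ * A, f₁ - g₀ * w₁ - g₁ * w₀ + g₁ * w₁, g₀, g₁], ?_⟩
      simp only [Fin.sum_univ_four, towerBasis, Matrix.cons_val, ← tower, ← map_mul, ← map_add,
        mul_one]
      congr 1
      simp only [map_sub, map_add, map_mul]
      linear_combination -algebraMap k[X] R g₁ * algebraMap k[X] R w₁ * hρ -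
        (algebraMap k[X] R g₀ + algebraMap k[X] R g₁ * ρ) * hs
    · rintro ⟨f, rfl⟩
      refine sum_mem fun j _ => mul_mem ⟨_, tower _⟩ ?_
      fin_cases j
      · exact one_mem _
      · exact ⟨ρ, rfl⟩
      · exact ⟨s, rfl⟩
      · exact ⟨ρ * s, map_mul _ _ _⟩
  refine ⟨q, hd, ht.genus_eq hinj hR fun x => ?_⟩
  obtain ⟨y, z, hz, hy⟩ := exists_algebraMap_mul_eq k[X] R F x
  obtain ⟨f, hf⟩ := (hR _).mp ⟨y, rfl⟩
  refine ⟨f, z, hz, ?_⟩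
  have hz0 : algebraMap k[X] F z ≠ 0 := fun h => hz (hinj (by rw [map_zero, h]))
  rw [← hy] at hf
  rw [← mul_right_inj' hz0, hf, Finset.mul_sum]
  refine Finset.sum_congr rfl fun j _ => ?_
  rw [← mul_assoc, mul_div_cancel₀ _ hz0]

theorem algebraMap_coordRingC_injective (hA : Odd A.natDegree) :
    Function.Injective (algebraMap k[X] (CoordRingC A B)) := by
  have := isDomain_coordRingH hA
  have h : Function.Injective (algebraMap (CoordRingH A) (CoordRingC A B)) :=
    artinSchreier_of_injective _
  rw [IsScalarTower.algebraMap_eq k[X] (CoordRingH A) (CoordRingC A B)]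
  exact h.comp algebraMap_coordRingH_injective

theorem artinSchreier_coordRingH_exists_eq (c : CoordRingH A) (y : AdjoinRoot (X ^ 2 + X - C c)) :
    ∃ f₀ f₁ g₀ g₁ : k[X], y = algebraMap k[X] _ f₀ + algebraMap k[X] _ f₁ * AdjoinRoot.of _ (r A) +
      (algebraMap k[X] _ g₀ + algebraMap k[X] _ g₁ * AdjoinRoot.of _ (r A)) *
        AdjoinRoot.root _ := by
  have tower : ∀ f : k[X], AdjoinRoot.of (X ^ 2 + X - C c) (AdjoinRoot.of _ f) =
      algebraMap k[X] _ f := fun f => rfl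
  obtain ⟨a, b, rfl⟩ := artinSchreier_exists_eq c y
  obtain ⟨f₀, f₁, rfl⟩ := artinSchreier_exists_eq A a
  obtain ⟨g₀, g₁, rfl⟩ := artinSchreier_exists_eq A b
  exact ⟨f₀, f₁, g₀, g₁, by simp only [map_add, map_mul, tower]⟩

theorem exists_genus_eq [CharP k 2] [PerfectField k] [IsDomain (CoordRingC A B)]
    (hA : Odd A.natDegree) (hB : Odd B.natDegree) :
    ∃ q : k[X], q.natDegree = max A.natDegree (B.natDegree - A.natDegree) ∧
      genus k (FractionRing (CoordRingC A B)) =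
        ∑ i, (2 * q.natDegree + 3 * A.natDegree - 1 - towerPole A q i) / 4 := by
  have := isDedekindDomain_coordRingC (B := B) hA
  have := formallyEtale_fractionRing (B := B) hA
  have hinj : Function.Injective (algebraMap k[X] (FractionRing (CoordRingC A B))) := by
    rw [IsScalarTower.algebraMap_eq k[X] (CoordRingC A B)]
    exact (IsFractionRing.injective (CoordRingC A B) _).comp (algebraMap_coordRingC_injective hA)
  refine exists_genus_eq_of_generators (R := CoordRingC A B) (ρ := AdjoinRoot.of _ (r A))
    (σ := AdjoinRoot.root _) hA hB hinj ?_ ?_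
    (artinSchreier_coordRingH_exists_eq _)
  · rw [← map_pow (AdjoinRoot.of _), ← map_add (AdjoinRoot.of _), artinSchreier_root A]
    rfl
  · refine (artinSchreier_root _).trans ?_
    rw [map_add (AdjoinRoot.of _), map_mul (AdjoinRoot.of _)]
    rfl

end Genus
end ArtinSchreierQuartic

end

theorem mainTheorem7 {k : Type*} [Field k] [PerfectField k] [CharP k 2] (A B : k[X])
    (hA : Odd A.natDegree) (hB : Odd B.natDegree) :
    ∃ _ : IsDomain (ArtinSchreierQuartic.CoordRingC A B),
      (ArtinSchreierQuartic.genus k (FractionRing (ArtinSchreierQuartic.CoordRingC A B)) : ℚ) =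
        max ((5 * (A.natDegree : ℚ) - 3) / 2)
          ((2 * (B.natDegree : ℚ) + (A.natDegree : ℚ) - 3) / 2) := by
  have hdom := ArtinSchreierQuartic.isDomain_coordRingC hA hB
  refine ⟨hdom, ?_⟩
  obtain ⟨q, hq, hg⟩ := ArtinSchreierQuartic.exists_genus_eq hA hB
  obtain ⟨a, ha⟩ := hA
  obtain ⟨b, hb⟩ := hB
  have key : 2 * ArtinSchreierQuartic.genus k
      (FractionRing (ArtinSchreierQuartic.CoordRingC A B)) + 3 =
      max (5 * A.natDegree) (2 * B.natDegree + A.natDegree) := by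
    -- With deg A = 2a + 1 the summands are ⌊(d + 3a + 1)/2⌋, ⌊(d + a)/2⌋, a and 0, the last by
    -- truncation. The first two numerators have opposite parity, so the total is d + 3a.
    rw [hg, Fin.sum_univ_four]
    simp only [ArtinSchreierQuartic.towerPole, Matrix.cons_val]
    omega
  have key' := congrArg (Nat.cast (R := ℚ)) key
  push_cast at key'
  rw [max_div_div_right (by norm_num : (0 : ℚ) ≤ 2), max_sub_sub_right, ← key']
  ring
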